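/- Let $n \ge 1$ agents and $m \ge 2n$ indivisible items be given. Agent $i$ has a private valuation $v_i$, which assigns a non-negative real value to every set of items; it is additive if $v_i(S)=\sum_{e\in S} v_i(\{e\})$ for all $S$. An allocation is a partition of the items into $n$ (possibly empty) bundles $A_1,\dots,A_n$, with $A_i$ given to agent $i$. It is EF1 if for all $i\neq j$ either $v_i(A_i)\ge v_i(A_j)$ or $v_i(A_i)\ge v_i(A_j\setminus\{e\})$ for some $e\in A_j$. In a deterministic protocol, agents are adaptively asked arbitrary queries about their own valuations, and the list of replies determines an allocation; the (deterministic) communication complexity of EF1 for a class of instances is the least, over all protocols that produce an EF1 allocation on every instance of the class, of the worst-case total number of bits sent in reply. The description complexity is the same quantity when all queries are directed to one special agent who knows all the valuations. Then, with absolute constants in the $O$-notation: 1. For additive valuations, the communication complexity of EF1 allocations is $O(m\log m)$. 2. For additive valuations, the description complexity of EF1 allocations is $O(n\log m)$. 3. For instances in which all agents have the same valuation, the communication complexity of EF1 allocations is $O(n\log\frac{m}{n})$. This holds for every class of monotone valuations (those with $v(S)\le v(T)$ whenever $S\subseteq T$), in particular for additive and for unit demand valuations ($v(S)=\max_{e\in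 S}v(\{e\})$). -/

import Mathlib

namespace FairAllocation

/-- A deterministic protocol: a decision tree whose inner nodes query an agent. The agent `i`
who is queried transmits one bit, an arbitrary function `q` of her own private input, and the
protocol continues according to that bit. A leaf declares the output. (A reply of `k` bits is
given as `k` consecutive one-bit replies of the same agent.) -/
inductive Protocol (Agent Input Output : Type) : Type where
  | output (o : Output) : Protocol Agent Input Output
  | query (i : Agent) (q : Input → Bool) (next : Bool → Protocol Agent Input Output) :
      Protocol Agent Input Output

namespace Protocol

variable {Agent Input Output : Type}

/-- The list of bits transmitted by the agents when `x i` is the private input of agent `i`. -/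
def transcript : Protocol Agent Input Output → (Agent → Input) → List Bool
  | .output _, _ => []
  | .query i q next, x => q (x i) :: (next (q (x i))).transcript x

/-- The output of the protocol when `x i` is the private input of agent `i`. -/
def result : Protocol Agent Input Output → (Agent → Input) → Output
  | .output o, _ => o
  | .query i q next, x => (next (q (x i))).result x

end Protocol

/-- The deterministic communication complexity of finding an acceptable output on the inputs from
`I`: the least, over all protocols that are correct on every input from `I`, of the
worst-case number of transmitted bits over `I`. It is `⊤` if there is no such protocol of bounded
transcript length. -/
noncomputable def communicationComplexity {Agent Input Output : Type}
    (I : Set (Agent → Input)) (Acceptable : (Agent → Input) → Output → Prop) : ℕ∞ :=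
  ⨅ (P : Protocol Agent Input Output) (_ : ∀ x ∈ I, Acceptable x (P.result x)),
    ⨆ x ∈ I, ((P.transcript x).length : ℕ∞)

/-- The deterministic description complexity: the communication complexity when all queries are
directed to a single special agent, whose private input is the whole instance. -/
noncomputable def descriptionComplexity {Agent Input Output : Type}
    (I : Set (Agent → Input)) (Acceptable : (Agent → Input) → Output → Prop) : ℕ∞ :=
  communicationComplexity (Agent := Unit) (Input := Agent → Input)
    {y | y () ∈ I} (fun y o => Acceptable (y ()) o)

/-- A function assigning a real value to every set of items, the items being `Fin m`. -/
abbrev Valuation (m : ℕ) : Type := Finset (Fin m) → ℝ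

/-- An allocation of `m` items to `n` agents: every item is given to exactly one agent. -/
abbrev Allocation (n m : ℕ) : Type := Fin m → Fin n

/-- The bundle of items that agent `i` receives. -/
def Allocation.bundle {n m : ℕ} (A : Allocation n m) (i : Fin n) : Finset (Fin m) :=
  Finset.univ.filter (fun e => A e = i)

/-- Envy-freeness up to one item. -/
def IsEF1 {n m : ℕ} (v : Fin n → Valuation m) (A : Allocation n m) : Prop :=
  ∀ i j : Fin n, i ≠ j →
    v i (A.bundle j) ≤ v i (A.bundle i) ∨
      ∃ e ∈ A.bundle j, v i (A.bundle j \ {e}) ≤ v i (A.bundle i)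

/-- The additive valuations with non-negative item values. -/
def additiveValuations (m : ℕ) : Set (Valuation m) :=
  {v | ∃ w : Fin m → ℝ, (∀ e, 0 ≤ w e) ∧ ∀ S, v S = ∑ e ∈ S, w e}

/-- The non-negative monotone valuations; they include the additive and the unit demand ones. -/
def monotoneValuations (m : ℕ) : Set (Valuation m) :=
  {v | (∀ S, 0 ≤ v S) ∧ Monotone v}

/-- The instances with `n` agents, each having a valuation from the class `C`. -/
def instances (n : ℕ) {m : ℕ} (C : Set (Valuation m)) : Set (Fin n → Valuation m) :=
  {v | ∀ i, v i ∈ C}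

/-- The instances with `n` agents who all have the same valuation, which belongs to `C`. -/
def identicalInstances (n : ℕ) {m : ℕ} (C : Set (Valuation m)) : Set (Fin n → Valuation m) :=
  {v | ∃ u ∈ C, ∀ i, v i = u}

end FairAllocation

open FairAllocation

/-!
For additive valuations, round robin with the agents choosing in turn produces an EF1 allocation,
and each of the `m` choices takes `O(log m)` bits.

For monotone valuations, place the items on an interval of length `2 * m` so that each item has
length `2`, and divide the interval into `n` consecutive pieces with integral ends. These divisions
are the lattice points of a dilated simplex, which has the Kuhn triangulation. Label a division,
considered as a vertex for agent `i`, with the piece of positive length that agent `i` likes best.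
By Sperner's lemma, some cell of the triangulation has vertices whose labels, for agents `1` to `n`
respectively, are all different: each agent gets the best piece of a division of their own. The
divisions of a cell differ by at most half an item at each end of a piece. Hence the pieces taken
from these divisions are disjoint, and as a piece never gains an item at both ends, each of them
exceeds the corresponding piece of another division by at most one item. Items left over can be
added to pieces that do not exceed the corresponding pieces at all, one item to each, and there are
enough of these pieces.

One division, the shifts of the ends, and the set of the pieces that may receive an additional item
describe the bundles. There are only `2 ^ O(n) * choose (n + 2 * m - 1) (2 * m)` such descriptions,
so that `O(n * log (m / n))` bits suffice. The description of who gets which bundle takes another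
`O(n * log n)` bits, unless the valuations are identical.
-/

namespace FairAllocation

section Protocols

namespace Protocol

variable {Agent Input Output : Type}

/-- Agent `i` answers the queries in the list one after another, and the protocol continues with
the tree that `k` assigns to the list of answers. -/
def askBits (i : Agent) :
    List (Input → Bool) → (List Bool → Protocol Agent Input Output) → Protocol Agent Input Output
  | [], k => k []
  | q :: qs, k => .query i q fun c => askBits i qs fun r => k (c :: r)

theorem result_askBits (i : Agent) (qs : List (Input → Bool))
    (k : List Bool → Protocol Agent Input Output) (x : Agent → Input) :
    (askBits i qs k).result x = (k (qs.map (· (x i)))).result x := by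
  induction qs generalizing k with
  | nil => rfl
  | cons q _ ih => exact ih _

theorem transcript_askBits (i : Agent) (qs : List (Input → Bool))
    (k : List Bool → Protocol Agent Input Output) (x : Agent → Input) :
    (askBits i qs k).transcript x =
      qs.map (· (x i)) ++ (k (qs.map (· (x i)))).transcript x := by
  induction qs generalizing k with
  | nil => rfl
  | cons q qs ih => exact congrArg (q (x i) :: ·) (ih _)

theorem exists_ask {K : Type} [Fintype K] [Nonempty K] {b : ℕ} (hK : Fintype.card K ≤ 2 ^ b)
    (i : Agent) (f : Input → K) (next : K → Protocol Agent Input Output) :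
    ∃ P : Protocol Agent Input Output, ∀ x, P.result x = (next (f (x i))).result x ∧
      (P.transcript x).length = b + ((next (f (x i))).transcript x).length := by
  obtain ⟨code⟩ : Nonempty (K ↪ (Fin b → Bool)) :=
    Function.Embedding.nonempty_of_card_le (by simpa using hK)
  have hcode : Function.Injective fun κ => List.ofFn (code κ) :=
    List.ofFn_injective.comp code.injective
  have hanswers : ∀ u, (List.ofFn fun j u => code (f u) j).map (· u) = List.ofFn (code (f u)) :=
    fun u => by simp [List.map_ofFn, Function.comp_def]
  refine ⟨askBits i (List.ofFn fun j u => code (f u) j)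
    (next ∘ Function.invFun fun κ => List.ofFn (code κ)), fun x => ⟨?_, ?_⟩⟩
  · rw [result_askBits, hanswers, Function.comp_apply, Function.leftInverse_invFun hcode]
  · rw [transcript_askBits, hanswers, Function.comp_apply, Function.leftInverse_invFun hcode,
      List.length_append, List.length_ofFn]

end Protocol

variable {Agent Input Output : Type} {I : Set (Agent → Input)}
  {Acceptable : (Agent → Input) → Output → Prop}

theorem communicationComplexity_le {b : ℕ} (P : Protocol Agent Input Output)
    (hP : ∀ x ∈ I, Acceptable x (P.result x) ∧ (P.transcript x).length ≤ b) :
    communicationComplexity I Acceptable ≤ b :=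
  iInf₂_le_of_le P (fun x hx => (hP x hx).1) (iSup₂_le fun x hx => by exact_mod_cast (hP x hx).2)

theorem communicationComplexity_le_clog_card {K : Type} [Fintype K] [Nonempty K] (i : Agent)
    (decode : K → Output)
    (h : ∀ x ∈ I, ∃ κ, ∀ x' ∈ I, x' i = x i → Acceptable x' (decode κ)) :
    communicationComplexity I Acceptable ≤ Nat.clog 2 (Fintype.card K) := by
  have hcode : ∀ u : Input, ∃ κ, ∀ x' ∈ I, x' i = u → Acceptable x' (decode κ) := by
    intro u
    by_cases hu : ∃ x ∈ I, x i = u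
    · obtain ⟨x, hx, rfl⟩ := hu
      exact h x hx
    · exact ⟨Classical.arbitrary K, fun x' hx' hu' => (hu ⟨x', hx', hu'⟩).elim⟩
  choose f hf using hcode
  obtain ⟨P, hP⟩ := Protocol.exists_ask (Nat.le_pow_clog one_lt_two (Fintype.card K)) i f
    fun κ => .output (decode κ)
  refine communicationComplexity_le P fun x hx => ⟨?_, (hP x).2.le⟩
  rw [(hP x).1]
  exact hf (x i) x hx rfl

theorem toENNReal_le_ofReal {a : ℕ∞} {b : ℕ} {r : ℝ} (h : a ≤ b) (hb : (b : ℝ) ≤ r) :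
    (a : ENNReal) ≤ ENNReal.ofReal r := by
  calc (a : ENNReal) ≤ ((b : ℕ∞) : ENNReal) := by exact_mod_cast h
    _ = ENNReal.ofReal b := by simp
    _ ≤ ENNReal.ofReal r := ENNReal.ofReal_le_ofReal hb

theorem natClog_two_le (c : ℕ) : (Nat.clog 2 c : ℝ) ≤ 2 * Real.logb 2 c := by
  rcases lt_or_ge c 2 with hc | hc
  · interval_cases c <;> simp
  · have h1 : 1 ≤ Real.logb 2 c := by
      rw [Real.le_logb_iff_rpow_le one_lt_two (by positivity), Real.rpow_one]
      exact_mod_cast hc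
    have hceil := Nat.ceil_lt_add_one (zero_le_one.trans h1)
    rw [← Nat.cast_two, Real.natCeil_logb_natCast] at hceil
    push_cast at hceil
    linarith

end Protocols

section RoundRobin

variable {n m : ℕ} [NeZero n] {v : Fin n → Valuation m}

/-- An agent with valuation `u` may pick the item `e` when the items in `L` are gone: no other
remaining item is worth more to her. -/
def IsFavourite (u : Valuation m) (L : List (Fin m)) (e : Fin m) : Prop :=
  e ∉ L ∧ ∀ e' ∉ L, u {e'} ≤ u {e}

/-- The items in `L` have been picked in this order by agents who take turns, the pick of round
`s` (counted from `0`) being a favourite remaining item of agent `s % n`. -/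
def IsGreedy (v : Fin n → Valuation m) (L : List (Fin m)) : Prop :=
  ∀ s (hs : s < L.length), IsFavourite (v (Fin.ofNat n s)) (L.take s) L[s]

theorem exists_isFavourite {L : List (Fin m)} (hL : L.length < m) (u : Valuation m) :
    ∃ e, IsFavourite u L e := by
  have hne : (L.toFinsetᶜ).Nonempty := by
    rw [← Finset.card_pos, Finset.card_compl, Fintype.card_fin, tsub_pos_iff_lt]
    exact L.toFinset_card_le.trans_lt hL
  obtain ⟨e, he, hmax⟩ := Finset.exists_max_image _ (fun e => u {e}) hne
  exact ⟨e, by simpa using he, fun e' he' => hmax e' (by simpa using he')⟩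

theorem IsGreedy.append {L : List (Fin m)} (hL : IsGreedy v L) {e : Fin m}
    (he : IsFavourite (v (Fin.ofNat n L.length)) L e) : IsGreedy v (L ++ [e]) := by
  intro s hs
  rw [List.length_append, List.length_singleton, Nat.lt_succ_iff_lt_or_eq] at hs
  rcases hs with hs | rfl
  · rw [List.take_append_of_le_length hs.le, List.getElem_append_left hs]
    exact hL s hs
  · simpa using he

theorem exists_protocol_isGreedy {Output : Type} (out : List (Fin m) → Output) (k : ℕ)
    (L : List (Fin m)) (hk : L.length + k = m) :
    ∃ P : Protocol (Fin n) (Valuation m) Output, ∀ v, IsGreedy v L →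
      (∃ L', IsGreedy v L' ∧ L'.length = m ∧ P.result v = out L') ∧
        (P.transcript v).length = k * Nat.clog 2 m := by
  induction k generalizing L with
  | zero => exact ⟨.output (out L), fun v hv => ⟨⟨L, hv, hk, rfl⟩, by simp [Protocol.transcript]⟩⟩
  | succ k ih =>
    have hL : L.length < m := by omega
    have : NeZero m := ⟨by omega⟩
    choose pick hpick using exists_isFavourite hL
    choose next hnext using fun e => ih (L ++ [e]) (by
      rw [List.length_append, List.length_singleton]
      omega)
    obtain ⟨P, hP⟩ := Protocol.exists_ask
      ((Fintype.card_fin m).trans_le (Nat.le_pow_clog one_lt_two m)) (Fin.ofNat n L.length)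
      pick next
    refine ⟨P, fun v hv => ?_⟩
    obtain ⟨hresult, hlength⟩ := hnext _ v (hv.append (hpick (v (Fin.ofNat n L.length))))
    rw [(hP v).1, (hP v).2, hlength]
    exact ⟨hresult, by ring⟩

/-- `σ t` is the item picked in round `t` of a complete round robin, in which no agent prefers an
item picked later to the one she picks. -/
def IsPickingOrder (v : Fin n → Valuation m) (σ : Equiv.Perm (Fin m)) : Prop :=
  ∀ s t : Fin m, s ≤ t → v (Fin.ofNat n s) {σ t} ≤ v (Fin.ofNat n s) {σ s}

theorem IsGreedy.exists_isPickingOrder {L : List (Fin m)} (hL : IsGreedy v L)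
    (hlen : L.length = m) :
    ∃ σ : Equiv.Perm (Fin m), IsPickingOrder v σ ∧ ∀ e, L.idxOf e = σ.symm e := by
  have hlater : ∀ s t (_ : s ≤ t) (ht : t < L.length), L[t] ∉ L.take s := fun s t hst ht h =>
    (hL t ht).1 (List.take_subset_take_left L hst h)
  have hnodup : L.Nodup := List.pairwise_iff_getElem.2 fun s t hs ht hst heq =>
    hlater t t le_rfl ht (List.mem_take_iff_getElem.2 ⟨s, by omega, heq⟩)
  have hinj : Function.Injective (L.get ∘ Fin.cast hlen.symm) :=
    hnodup.injective_get.comp (Fin.cast_injective _)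
  let σ := Equiv.ofBijective _ (Finite.injective_iff_bijective.1 hinj)
  refine ⟨σ, fun s t hst => ?_, fun e => ?_⟩
  · exact (hL s (by omega)).2 _ (hlater s t hst (by omega))
  · obtain ⟨t, rfl⟩ := σ.surjective e
    rw [σ.symm_apply_apply]
    exact hnodup.idxOf_getElem _ _

/-- The allocation that gives the item picked in round `t` to agent `t % n`. -/
def turnAllocation (n : ℕ) [NeZero n] (σ : Equiv.Perm (Fin m)) : Allocation n m :=
  fun e => Fin.ofNat n (σ.symm e)

theorem ofNat_eq_iff_exists_add_mul {t : ℕ} {i : Fin n} :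
    Fin.ofNat n t = i ↔ ∃ a, t = i + n * a := by
  constructor
  · rintro rfl
    exact ⟨t / n, (Nat.mod_add_div t n).symm⟩
  · rintro ⟨a, rfl⟩
    exact Fin.ext (by simp [Nat.mod_eq_of_lt i.2])

variable {σ : Equiv.Perm (Fin m)}

theorem mem_bundle_turnAllocation {i : Fin n} {e : Fin m} :
    e ∈ (turnAllocation n σ).bundle i ↔ Fin.ofNat n (σ.symm e) = i :=
  Finset.mem_filter_univ e

theorem IsPickingOrder.le_bundle (hσ : IsPickingOrder v σ)
    (hv : v ∈ instances n (additiveValuations m)) {i : Fin n} {S : Finset (Fin m)} {d : ℕ}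
    (hS : ∀ e ∈ S, d ≤ σ.symm e ∧ Fin.ofNat n (σ.symm e - d) = i) :
    v i S ≤ v i ((turnAllocation n σ).bundle i) := by
  obtain ⟨w, hw, hadd⟩ := hv i
  let earlier (e : Fin m) : Fin m := σ ⟨(σ.symm e : ℕ) - d, by omega⟩
  have hle : ∀ e ∈ S, w e ≤ w (earlier e) := fun e he => by
    have h := hσ ⟨(σ.symm e : ℕ) - d, by omega⟩ (σ.symm e) (Nat.sub_le _ _)
    rw [(hS e he).2] at h
    simpa [hadd] using h
  have hinj : Set.InjOn earlier S := fun e he e' he' h => by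
    have h := congrArg Fin.val (σ.injective h)
    have := (hS e he).1
    have := (hS e' he').1
    exact σ.symm.injective (Fin.ext (by dsimp only at h; omega))
  have hsub : S.image earlier ⊆ (turnAllocation n σ).bundle i := fun e he => by
    obtain ⟨e, heS, rfl⟩ := Finset.mem_image.1 he
    rw [mem_bundle_turnAllocation, σ.symm_apply_apply]
    exact (hS e heS).2
  calc v i S = ∑ e ∈ S, w e := hadd S
    _ ≤ ∑ e ∈ S, w (earlier e) := Finset.sum_le_sum hle
    _ = ∑ e ∈ S.image earlier, w e := (Finset.sum_image hinj).symm
    _ ≤ ∑ e ∈ (turnAllocation n σ).bundle i, w e :=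
      Finset.sum_le_sum_of_subset_of_nonneg hsub fun e _ _ => hw e
    _ = v i ((turnAllocation n σ).bundle i) := (hadd _).symm

theorem IsPickingOrder.isEF1 (hσ : IsPickingOrder v σ)
    (hv : v ∈ instances n (additiveValuations m)) : IsEF1 v (turnAllocation n σ) := by
  intro i j hij
  have hround : ∀ e ∈ (turnAllocation n σ).bundle j, ∃ a, (σ.symm e : ℕ) = j + n * a :=
    fun e he => ofNat_eq_iff_exists_add_mul.1 (mem_bundle_turnAllocation.1 he)
  rcases hij.lt_or_gt with hlt | hgt
  · refine .inl (hσ.le_bundle hv (d := j - i) fun e he => ?_)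
    obtain ⟨a, ha⟩ := hround e he
    exact ⟨by omega, ofNat_eq_iff_exists_add_mul.2 ⟨a, by omega⟩⟩
  · have hrest : ∀ S ⊆ (turnAllocation n σ).bundle j, (∀ e ∈ S, (σ.symm e : ℕ) ≠ j) →
        v i S ≤ v i ((turnAllocation n σ).bundle i) := fun S hS hne =>
      hσ.le_bundle hv (d := n + j - i) fun e he => by
        obtain ⟨_ | a, ha⟩ := hround e (hS he)
        · exact (hne e he (by simpa using ha)).elim
        · rw [mul_add, mul_one] at ha
          exact ⟨by omega, ofNat_eq_iff_exists_add_mul.2 ⟨a, by omega⟩⟩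
    by_cases hfirst : ∃ e ∈ (turnAllocation n σ).bundle j, (σ.symm e : ℕ) = j
    · obtain ⟨e, he, hej⟩ := hfirst
      refine .inr ⟨e, he, hrest _ Finset.sdiff_subset fun e' he' h => ?_⟩
      rw [Finset.mem_sdiff, Finset.mem_singleton] at he'
      exact he'.2 (σ.symm.injective (Fin.ext (h.trans hej.symm)))
    · exact .inl (hrest _ subset_rfl fun e he h => hfirst ⟨e, he, h⟩)

variable (n m) in
theorem communicationComplexity_additive_le :
    communicationComplexity (instances n (additiveValuations m)) IsEF1 ≤
      (m * Nat.clog 2 m : ℕ) := by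
  obtain ⟨P, hP⟩ := exists_protocol_isGreedy (n := n) (m := m)
    (fun L e => Fin.ofNat n (L.idxOf e)) m [] (Nat.zero_add m)
  refine communicationComplexity_le P fun v hv => ?_
  obtain ⟨⟨L, hL, hlen, hresult⟩, hlength⟩ := hP v fun s hs => by simp at hs
  obtain ⟨σ, hσ, hidx⟩ := hL.exists_isPickingOrder hlen
  simp only [hresult, hidx]
  exact ⟨hσ.isEF1 hv, hlength.le⟩

end RoundRobin

section Kuhn

variable {N : ℕ}

/-- The elementary move of the Kuhn triangulation: a unit goes from coordinate `a + 1` to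
coordinate `a`. -/
def transfer (a : Fin (N + 2)) : Fin (N + 2) → ℤ := Pi.single a 1 - Pi.single (a + 1) 1

theorem transfer_apply (a k : Fin (N + 2)) :
    transfer a k = (if a = k then 1 else 0) - (if a + 1 = k then 1 else 0) := by
  simp [transfer, Pi.single_apply, eq_comm]

theorem transfer_injective : Function.Injective (transfer (N := N)) := by
  intro a b h
  have ha := congrFun h a
  by_contra hne
  rw [transfer_apply, transfer_apply, if_pos rfl, if_neg (by simp), if_neg (Ne.symm hne)] at ha
  split_ifs at ha <;> omega

/-- The sum of the coordinates of a point, each weighted by its own index modulo the dimension.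
As every elementary move lowers it by one, it tells the position of a vertex in its simplex. -/
def weight : (Fin (N + 2) → ℤ) →ₗ[ℤ] Fin (N + 2) := Fintype.linearCombination ℤ id

theorem weight_single (a : Fin (N + 2)) (r : ℤ) : weight (Pi.single a r) = r • a :=
  Fintype.linearCombination_apply_single ℤ id a r

/-- The cyclic sequence of points `z` runs through the vertices of a simplex of the Kuhn
triangulation: consecutive vertices differ by an elementary move, and every move occurs once. -/
def IsKuhnCycle (z : Fin (N + 2) → Fin (N + 2) → ℤ) : Prop :=
  ∃ τ : Equiv.Perm (Fin (N + 2)), ∀ i, z (i + 1) = z i + transfer (τ i)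

theorem apply_eq_of_cyclic_increments {n : ℕ} {f : Fin (n + 1) → ℤ} {p q : Fin (n + 1)}
    (hf : ∀ j, f (j + 1) = f j + (if j = p then 1 else 0) - (if j = q then 1 else 0))
    (j : Fin (n + 1)) :
    f j = f 0 + (if p < j then 1 else 0) - (if q < j then 1 else 0) := by
  induction j using Fin.induction with
  | zero => simp
  | succ j ih =>
    have hstep : ∀ p : Fin (n + 1), (if p < j.succ then 1 else 0 : ℤ) =
        (if p < j.castSucc then 1 else 0) + (if j.castSucc = p then 1 else 0) := fun p => by
      simp only [Fin.lt_def, Fin.ext_iff, Fin.val_succ, Fin.val_castSucc]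
      split_ifs <;> omega
    rw [hstep, hstep, ← Fin.coeSucc_eq_succ, hf, ih]
    ring

variable {z : Fin (N + 2) → Fin (N + 2) → ℤ}

theorem IsKuhnCycle.exists_increments (h : IsKuhnCycle z) (φ : (Fin (N + 2) → ℤ) →+ ℤ)
    {b c : Fin (N + 2)}
    (hφ : ∀ a, φ (transfer a) = (if a = b then 1 else 0) - (if a = c then 1 else 0)) :
    ∃ p q, ∀ j, φ (z (j + 1)) =
      φ (z j) + (if j = p then 1 else 0) - (if j = q then 1 else 0) := by
  obtain ⟨τ, hτ⟩ := h
  refine ⟨τ.symm b, τ.symm c, fun j => ?_⟩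
  simp only [hτ j, map_add, hφ, Equiv.eq_symm_apply, add_sub_assoc]

theorem IsKuhnCycle.abs_sub_le (h : IsKuhnCycle z) (φ : (Fin (N + 2) → ℤ) →+ ℤ)
    {b c : Fin (N + 2)}
    (hφ : ∀ a, φ (transfer a) = (if a = b then 1 else 0) - (if a = c then 1 else 0))
    (i j : Fin (N + 2)) : |φ (z j) - φ (z i)| ≤ 1 := by
  obtain ⟨p, q, hpq⟩ := h.exists_increments φ hφ
  rw [apply_eq_of_cyclic_increments (f := fun j => φ (z j)) hpq j,
    apply_eq_of_cyclic_increments (f := fun j => φ (z j)) hpq i, abs_le]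
  rcases lt_trichotomy p q with hlt | rfl | hlt <;> constructor <;> split_ifs <;> omega

theorem coord_transfer (k a : Fin (N + 2)) :
    Pi.evalAddMonoidHom (fun _ => ℤ) k (transfer a) =
      (if a = k then 1 else 0) - (if a = k - 1 then 1 else 0) := by
  simp only [Pi.evalAddMonoidHom_apply, transfer_apply, eq_sub_iff_add_eq]

theorem IsKuhnCycle.abs_coord_sub_le (h : IsKuhnCycle z) (k i j : Fin (N + 2)) :
    |z j k - z i k| ≤ 1 :=
  h.abs_sub_le (Pi.evalAddMonoidHom _ k) (coord_transfer k) i j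

/-- The reflection of a simplex in its facet opposite to the vertex `z i`: the other simplex that
has this facet. -/
def reflect (z : Fin (N + 2) → Fin (N + 2) → ℤ) (i : Fin (N + 2)) :
    Fin (N + 2) → Fin (N + 2) → ℤ :=
  Function.update z i (z (i - 1) + z (i + 1) - z i)

theorem reflect_self (z : Fin (N + 2) → Fin (N + 2) → ℤ) (i : Fin (N + 2)) :
    reflect z i i = z (i - 1) + z (i + 1) - z i :=
  Function.update_self ..

theorem reflect_of_ne {i j : Fin (N + 2)} (hj : j ≠ i) : reflect z i j = z j :=
  Function.update_of_ne hj ..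

theorem reflect_reflect (z : Fin (N + 2) → Fin (N + 2) → ℤ) (i : Fin (N + 2)) :
    reflect (reflect z i) i = z := by
  funext j
  rcases eq_or_ne j i with rfl | hj
  · rw [reflect_self, reflect_self, reflect_of_ne (by simp), reflect_of_ne (by simp),
      sub_sub_cancel]
  · rw [reflect_of_ne hj, reflect_of_ne hj]

theorem IsKuhnCycle.reflect_ne (h : IsKuhnCycle z) (i : Fin (N + 2)) : reflect z i ≠ z := by
  obtain ⟨τ, hτ⟩ := h
  intro heq
  have hi := congrFun heq i
  have hprev := hτ (i - 1)
  rw [sub_add_cancel] at hprev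
  rw [reflect_self, hτ i, add_sub_assoc, add_sub_cancel_left, hprev, add_right_inj] at hi
  simpa using (τ.injective (transfer_injective hi)).symm

theorem IsKuhnCycle.isKuhnCycle_reflect (h : IsKuhnCycle z) (i : Fin (N + 2)) :
    IsKuhnCycle (reflect z i) := by
  obtain ⟨τ, hτ⟩ := h
  have hprev := hτ (i - 1)
  rw [sub_add_cancel] at hprev
  refine ⟨τ * Equiv.swap (i - 1) i, fun j => ?_⟩
  rw [Equiv.Perm.mul_apply]
  rcases eq_or_ne j i with rfl | hj
  · rw [reflect_of_ne (by simp), reflect_self, Equiv.swap_apply_right, hprev]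
    abel
  rcases eq_or_ne (j + 1) i with rfl | hj'
  · rw [reflect_self, reflect_of_ne hj, add_sub_cancel_right, Equiv.swap_apply_left, hτ (j + 1)]
    abel
  · rw [reflect_of_ne hj', reflect_of_ne hj, hτ,
      Equiv.swap_apply_of_ne_of_ne (by rwa [ne_eq, eq_sub_iff_add_eq]) hj]

/-- A simplex of the Kuhn triangulation of the points with coordinates at least `-1` and sum `M`,
with its vertices numbered such that the number of a vertex is a function of the vertex. -/
structure IsRoom (M : ℤ) (z : Fin (N + 2) → Fin (N + 2) → ℤ) : Prop where
  isKuhnCycle : IsKuhnCycle z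
  neg_one_le : ∀ i k, -1 ≤ z i k
  sum_eq : ∀ i, ∑ k, z i k = M
  weight_eq : ∀ i, weight (z i) = -i

variable {M : ℤ}

theorem IsRoom.isRoom_reflect (h : IsRoom M z) {i : Fin (N + 2)} (hi : ∀ k, -1 ≤ reflect z i i k) :
    IsRoom M (reflect z i) where
  isKuhnCycle := h.isKuhnCycle.isKuhnCycle_reflect i
  neg_one_le j := by
    rcases eq_or_ne j i with rfl | hj
    · exact hi
    · rw [reflect_of_ne hj]
      exact h.neg_one_le j
  sum_eq j := by
    rcases eq_or_ne j i with rfl | hj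
    · simp [reflect_self, Finset.sum_add_distrib, h.sum_eq]
    · rw [reflect_of_ne hj, h.sum_eq]
  weight_eq j := by
    rcases eq_or_ne j i with rfl | hj
    · rw [reflect_self, map_sub, map_add, h.weight_eq, h.weight_eq, h.weight_eq]
      abel
    · rw [reflect_of_ne hj, h.weight_eq]

theorem finite_setOf_isRoom (N : ℕ) (M : ℤ) :
    {z : Fin (N + 2) → Fin (N + 2) → ℤ | IsRoom M z}.Finite := by
  refine (Set.Finite.pi' fun _ => Set.Finite.pi' fun _ =>
    Set.finite_Icc (-1 : ℤ) (M + (N + 1))).subset fun z h i k => ⟨h.neg_one_le i k, ?_⟩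
  have hle : z i k + 1 ≤ ∑ j, (z i j + 1) :=
    Finset.single_le_sum (f := fun j => z i j + 1)
      (fun j _ => neg_le_iff_add_nonneg.1 (h.neg_one_le i j)) (Finset.mem_univ k)
  rw [Finset.sum_add_distrib, h.sum_eq] at hle
  simp only [Finset.sum_const, Finset.card_univ, Fintype.card_fin, Int.nsmul_eq_mul,
    Nat.cast_add, Nat.cast_ofNat, mul_one, Order.add_one_le_iff] at hle
  omega

theorem IsRoom.coord_eq_neg_one (h : IsRoom M z) {i k : Fin (N + 2)}
    (hk : reflect z i i k < -1) {j : Fin (N + 2)} (hj : j ≠ i) : z j k = -1 := by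
  obtain ⟨p, q, hpq⟩ := h.isKuhnCycle.exists_increments (Pi.evalAddMonoidHom _ k) (coord_transfer k)
  simp only [Pi.evalAddMonoidHom_apply] at hpq
  rw [reflect_self, Pi.sub_apply, Pi.add_apply] at hk
  have hprev := hpq (i - 1)
  have hnext := hpq i
  rw [sub_add_cancel] at hprev
  have := h.neg_one_le (i - 1) k
  have := h.neg_one_le (i + 1) k
  have hq : i = q := by split_ifs at hprev hnext <;> omega
  have hp : i - 1 = p := by split_ifs at hprev hnext <;> omega
  have hconst := apply_eq_of_cyclic_increments (p := 0) (q := 0)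
    (f := fun j => z j k - if j = i then 1 else 0) fun j => by
      simp only [hpq j, ← hp, ← hq, eq_sub_iff_add_eq]
      ring
  have hi := (hconst i).trans (add_sub_cancel_right ..)
  have hj' := (hconst j).trans (add_sub_cancel_right ..)
  simp only [hj, if_true, if_false] at hi hj'
  split_ifs at hprev hnext <;> omega

end Kuhn

section Sperner

/-- The `i`-th facet of a simplex with labels `L` is a door if its vertices carry all labels
except possibly `0`. -/
def IsDoor {ι α : Type*} [Zero α] (L : ι → α) (i : ι) : Prop :=
  ∀ a ≠ 0, ∃ j ≠ i, L j = a

theorem IsDoor.ne_zero_of_not_surjective {ι α : Type*} [Zero α] {L : ι → α} {i : ι}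
    (hi : IsDoor L i) (hL : ¬ Function.Surjective L) (j : ι) : L j ≠ 0 := by
  refine fun hj => hL fun a => ?_
  rcases eq_or_ne a 0 with rfl | ha
  · exact ⟨j, hj⟩
  · obtain ⟨j', -, hj'⟩ := hi a ha
    exact ⟨j', hj'⟩

open Classical in
theorem bijective_of_odd_card_isDoor {α : Type*} [Fintype α] [Zero α] {L : α → α}
    (h : Odd (Finset.univ.filter (IsDoor L)).card) : Function.Bijective L := by
  by_contra hbij
  have hsurj : ¬ Function.Surjective L := fun hs => hbij (Finite.surjective_iff_bijective.1 hs)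
  obtain ⟨i, hi⟩ := Finset.card_pos.1 h.pos
  replace hi : IsDoor L i := (Finset.mem_filter_univ i).1 hi
  have h0 := hi.ne_zero_of_not_surjective hsurj
  have hinj : Set.InjOn L (Finset.univ.erase i) :=
    Finset.injOn_of_surjOn_of_card_le (t := Finset.univ.erase 0) L (fun j _ => by simpa using h0 j)
      (fun a ha => by simpa using hi a (by simpa using ha)) (by simp)
  obtain ⟨i', hi', hLi⟩ := hi (L i) (h0 i)
  have hdoors : Finset.univ.filter (IsDoor L) = {i, i'} := by
    ext j
    rw [Finset.mem_filter_univ, Finset.mem_insert, Finset.mem_singleton]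
    refine ⟨fun hj => or_iff_not_imp_left.2 fun hji => ?_, ?_⟩
    · obtain ⟨j', hj', hLj⟩ := hj (L j) (h0 j)
      rcases eq_or_ne j' i with rfl | hj'i
      · exact hinj (by simpa using hji) (by simpa using hi') (hLj.symm.trans hLi.symm)
      · exact (hj' (hinj (by simpa using hj'i) (by simpa using hji) hLj)).elim
    · rintro (rfl | rfl)
      · exact hi
      · intro a ha
        obtain ⟨j', -, rfl⟩ := hi a ha
        rcases eq_or_ne j' j with rfl | hj'j
        · exact ⟨i, hi'.symm, hLi.symm⟩
        · exact ⟨j', hj'j, rfl⟩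
  rw [hdoors, Finset.card_pair hi'.symm] at h
  exact absurd h (by decide)

variable {N : ℕ} {M : ℤ} {z : Fin (N + 2) → Fin (N + 2) → ℤ}
  {l : (Fin (N + 2) → ℤ) → Fin (N + 2)}

/-- A labelling of the points with coordinates at least `-1` and sum `M` to which Sperner's
lemma applies. Outside the simplex proper the label `1` is a last resort, which leaves only one
door in the boundary. -/
structure IsSpernerLabelling (M : ℤ) (l : (Fin (N + 2) → ℤ) → Fin (N + 2)) : Prop where
  pos : ∀ y : Fin (N + 2) → ℤ, ∑ k, y k = M → 0 < y (l y)
  outside : ∀ y : Fin (N + 2) → ℤ, ¬ 0 ≤ y → l y = 1 → ∀ a ≠ 1, y a ≤ 0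

open Classical in
/-- The extension of a labelling of the points with non-negative coordinates to one to which
Sperner's lemma applies. -/
noncomputable def extendLabel (l : (Fin (N + 2) → ℤ) → Fin (N + 2)) (y : Fin (N + 2) → ℤ) :
    Fin (N + 2) :=
  if 0 ≤ y then l y else if h : ∃ a ≠ 1, 0 < y a then h.choose else 1

theorem isSpernerLabelling_extendLabel (hM : 0 < M)
    (hl : ∀ y : Fin (N + 2) → ℤ, 0 ≤ y → ∑ k, y k = M → 0 < y (l y)) :
    IsSpernerLabelling M (extendLabel l) where
  pos y hy := by
    rw [extendLabel]
    split_ifs with h0 h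
    · exact hl y h0 hy
    · exact h.choose_spec.2
    · by_contra h1
      push Not at h h1
      have hsum : ∑ k, y k ≤ 0 := Finset.sum_nonpos fun k _ => by
        rcases eq_or_ne k 1 with rfl | hk
        exacts [h1, h k hk]
      omega
  outside y hy h1 a ha := by
    rw [extendLabel, if_neg hy] at h1
    split_ifs at h1 with h
    · exact (h.choose_spec.1 h1).elim
    · push Not at h
      exact h a ha

variable (N M) in
/-- The vertices of the simplex that has the only door in the boundary. -/
def gate (i : Fin (N + 2)) : Fin (N + 2) → ℤ :=
  Pi.single 1 M - Pi.single 0 1 + Pi.single (-(M • 1) - i) 1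

theorem sum_single_sub_single :
    ∑ k, (Pi.single 1 M - Pi.single 0 1 : Fin (N + 2) → ℤ) k = M - 1 := by
  simp

theorem isRoom_gate (hM : 0 < M) : IsRoom M (gate N M) where
  isKuhnCycle := by
    refine ⟨Equiv.subLeft (-(M • 1) - 1), fun i => ?_⟩
    have hlast : -(M • (1 : Fin (N + 2))) - (i + 1) = -(M • 1) - 1 - i := by abel
    have hfirst : -(M • (1 : Fin (N + 2))) - 1 - i + 1 = -(M • 1) - i := by abel
    rw [gate, gate, transfer, Equiv.subLeft_apply, hlast, hfirst]
    abel
  neg_one_le i k := by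
    simp only [gate, Pi.add_apply, Pi.sub_apply, Pi.single_apply]
    split_ifs <;> omega
  sum_eq i := by simp [gate, Finset.sum_add_distrib]
  weight_eq i := by
    simp only [gate, map_add, map_sub, weight_single, one_smul, sub_zero]
    abel

theorem reflect_gate_apply_zero : reflect (gate N M) (-(M • 1)) (-(M • 1)) 0 = -2 := by
  simp [reflect_self, gate]

theorem isDoor_gate (hl : IsSpernerLabelling M l) (hM : 0 < M) :
    IsDoor (l ∘ gate N M) (-(M • 1)) := by
  intro a ha
  refine ⟨-(M • 1) - a, by simpa using ha, ?_⟩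
  have hgate : gate N M (-(M • 1) - a) = Pi.single 1 M - Pi.single 0 1 + Pi.single a 1 := by
    rw [gate, sub_sub_cancel]
  have hpos := hl.pos _ ((isRoom_gate hM).sum_eq (-(M • 1) - a))
  have houtside := hl.outside (gate N M (-(M • 1) - a)) fun h => by
    simpa [hgate, ha.symm] using h 0
  rw [Function.comp_apply]
  generalize l (gate N M (-(M • 1) - a)) = b at hpos houtside
  rw [hgate] at hpos houtside
  simp only [Pi.add_apply, Pi.sub_apply, Pi.single_apply] at hpos houtside
  by_contra hba
  have hb1 : b = 1 := by
    by_contra hb1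
    split_ifs at hpos <;> omega
  have ha1 := houtside hb1 a fun h => hba (hb1.trans h.symm)
  rw [if_neg fun h => hba (hb1.trans h.symm), if_neg ha, if_pos rfl] at ha1
  omega

theorem exists_eq_single_one {ι : Type*} [Fintype ι] [DecidableEq ι] {y : ι → ℤ} (h0 : 0 ≤ y)
    (h1 : ∑ k, y k = 1) : ∃ a, y = Pi.single a 1 := by
  obtain ⟨a, -, ha⟩ :=
    Finset.exists_lt_of_sum_lt (s := Finset.univ) (f := 0) (g := y) (by simp [h1])
  have hle : ∀ k, (Pi.single a 1 : ι → ℤ) k ≤ y k := fun k => by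
    rw [Pi.single_apply]
    split_ifs with hk
    · exact hk ▸ ha
    · exact h0 k
  refine ⟨a, funext fun k => Eq.symm ?_⟩
  exact (Finset.sum_eq_sum_iff_of_le fun k _ => hle k).1 (by simp [h1]) k (Finset.mem_univ k)

theorem IsRoom.eq_gate_of_le (h : IsRoom M z)
    (hz : ∀ i, Pi.single 1 M - Pi.single 0 1 ≤ z i) : z = gate N M := by
  funext i
  obtain ⟨a, ha⟩ := exists_eq_single_one (sub_nonneg.2 (hz i)) (by
    simp only [Pi.sub_apply (z i), Finset.sum_sub_distrib, h.sum_eq, sum_single_sub_single]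
    ring)
  rw [sub_eq_iff_eq_add] at ha
  have hw := h.weight_eq i
  simp only [ha, map_add, map_sub, weight_single, one_smul, sub_zero] at hw
  obtain rfl : a = -(M • 1) - i := by rw [eq_sub_of_add_eq hw, neg_sub_comm]
  rw [gate, ha]
  abel

theorem IsRoom.coord_zero_eq_neg_one (h : IsRoom M z) (hl : IsSpernerLabelling M l)
    {i : Fin (N + 2)} (hd : IsDoor (l ∘ z) i) {k : Fin (N + 2)} (hk : reflect z i i k < -1)
    {j : Fin (N + 2)} (hj : j ≠ i) : z j 0 = -1 := by
  suffices hk0 : k = 0 from hk0 ▸ h.coord_eq_neg_one hk hj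
  by_contra hk0
  obtain ⟨p, hp, hpk⟩ := hd k hk0
  have hpos := hl.pos (z p) (h.sum_eq p)
  rw [show l (z p) = k from hpk, h.coord_eq_neg_one hk hp] at hpos
  omega

theorem lt_apply_one_of_outside {y : Fin (N + 2) → ℤ} (h0 : y 0 = -1) (h1 : ∀ a ≠ 1, y a ≤ 0)
    (hy : ∑ k, y k = M) : M < y 1 := by
  have hle : y ≤ Pi.single 1 (y 1) - Pi.single 0 1 := fun k => by
    simp only [Pi.sub_apply, Pi.single_apply]
    split_ifs with hk1 hk0 hk0
    · simp [hk0] at hk1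
    · simp [hk1]
    · simp [hk0, h0]
    · simpa using h1 k hk1
  have hsum := Finset.sum_le_sum fun k (_ : k ∈ Finset.univ) => hle k
  rw [hy, sum_single_sub_single] at hsum
  omega

theorem IsRoom.eq_gate (h : IsRoom M z) (hl : IsSpernerLabelling M l) {i : Fin (N + 2)}
    (hd : IsDoor (l ∘ z) i) (hi : ∃ k, reflect z i i k < -1) :
    z = gate N M ∧ i = -(M • 1) := by
  obtain ⟨k, hk⟩ := hi
  have h0 : ∀ j ≠ i, z j 0 = -1 := fun j hj => h.coord_zero_eq_neg_one hl hd hk hj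
  have hnear := fun b p q => abs_le.1 (h.isKuhnCycle.abs_coord_sub_le b p q)
  obtain ⟨p, hpi, hp : l (z p) = 1⟩ := hd 1 one_ne_zero
  have hp1 : M < z p 1 :=
    lt_apply_one_of_outside (h0 p hpi)
      (hl.outside _ (fun h => by simpa [h0 p hpi] using h 0) hp) (h.sum_eq p)
  have hz : z = gate N M := h.eq_gate_of_le fun q b => by
    simp only [Pi.sub_apply, Pi.single_apply]
    have := hnear b p q
    have := h.neg_one_le q b
    split_ifs with hb1 hb0 hb0
    · simp [hb0] at hb1
    · subst hb1; omega
    · subst hb0; omega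
    · obtain ⟨r, -, hr : l (z r) = b⟩ := hd b hb0
      have := hl.pos (z r) (h.sum_eq r)
      have := hnear b r q
      simp only [hr] at *
      omega
  refine ⟨hz, ?_⟩
  by_contra hne
  simpa [hz, gate] using h0 _ (Ne.symm hne)

theorem IsRoom.isRoom_reflect_of_isDoor (h : IsRoom M z) (hl : IsSpernerLabelling M l)
    {i : Fin (N + 2)} (hd : IsDoor (l ∘ z) i) (hne : (z, i) ≠ (gate N M, -(M • 1))) :
    IsRoom M (reflect z i) := by
  refine h.isRoom_reflect ?_
  by_contra! hout
  obtain ⟨hz, hi⟩ := h.eq_gate hl hd hout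
  exact hne (Prod.ext hz hi)

theorem IsRoom.reflect_ne_gate (h : IsRoom M z) {i : Fin (N + 2)} :
    (reflect z i, i) ≠ (gate N M, -(M • 1)) := by
  intro heq
  obtain ⟨hz : reflect z i = gate N M, hi : i = -(M • 1)⟩ := Prod.mk.inj heq
  have h0 := h.neg_one_le i 0
  rw [← reflect_reflect z i, hz, hi, reflect_gate_apply_zero] at h0
  omega

theorem IsDoor.isDoor_reflect {i : Fin (N + 2)} (hd : IsDoor (l ∘ z) i) :
    IsDoor (l ∘ reflect z i) i := by
  intro a ha
  obtain ⟨j, hj, hja⟩ := hd a ha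
  exact ⟨j, hj, by simpa only [Function.comp_apply, reflect_of_ne hj] using hja⟩

theorem even_card_of_involution {α : Type*} {s : Finset α} (g : α → α) (hg : ∀ a ∈ s, g a ∈ s)
    (hne : ∀ a ∈ s, g a ≠ a) (hinv : ∀ a, g (g a) = a) : Even s.card := by
  have h : ∑ _a ∈ s, (1 : ZMod 2) = 0 :=
    Finset.sum_involution (fun a _ => g a) (fun _ _ => rfl) (fun a ha _ => hne a ha) hg
      fun a _ => hinv a
  rwa [Finset.sum_const, nsmul_one, ZMod.natCast_eq_zero_iff_even] at h

open Classical in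
theorem exists_isRoom_bijective (hM : 0 < M) (hl : IsSpernerLabelling M l) :
    ∃ z, IsRoom M z ∧ Function.Bijective (l ∘ z) := by
  let rooms := (finite_setOf_isRoom N M).toFinset
  let doors := (rooms ×ˢ Finset.univ).filter fun x => IsDoor (l ∘ x.1) x.2
  have mem_doors : ∀ x, x ∈ doors ↔ IsRoom M x.1 ∧ IsDoor (l ∘ x.1) x.2 := by simp [doors, rooms]
  have hgate : (gate N M, -(M • 1)) ∈ doors :=
    (mem_doors _).2 ⟨isRoom_gate hM, isDoor_gate hl hM⟩
  have heven : Even (doors.erase (gate N M, -(M • 1))).card := by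
    refine even_card_of_involution (fun x => (reflect x.1 x.2, x.2)) (fun x hx => ?_)
      (fun x hx heq => ?_) fun x => by simp only [reflect_reflect]
    · obtain ⟨hne, hx⟩ := Finset.mem_erase.1 hx
      obtain ⟨hroom, hdoor⟩ := (mem_doors _).1 hx
      exact Finset.mem_erase.2 ⟨hroom.reflect_ne_gate, (mem_doors _).2
        ⟨hroom.isRoom_reflect_of_isDoor hl hdoor hne, hdoor.isDoor_reflect⟩⟩
    · have hroom := ((mem_doors _).1 (Finset.mem_of_mem_erase hx)).1
      exact hroom.isKuhnCycle.reflect_ne x.2 (Prod.mk.inj heq).1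
  have hodd : Odd (∑ z ∈ rooms, (Finset.univ.filter (IsDoor (l ∘ z))).card) := by
    have hcard : doors.card = ∑ z ∈ rooms, (Finset.univ.filter (IsDoor (l ∘ z))).card := by
      simp only [doors, Finset.card_filter, Finset.sum_product]
    rw [← hcard, ← Finset.card_erase_add_one hgate]
    exact heven.add_one
  obtain ⟨z, hz, hzodd⟩ : ∃ z ∈ rooms, Odd (Finset.univ.filter (IsDoor (l ∘ z))).card := by
    by_contra! hno
    exact Nat.not_even_iff_odd.2 hodd
      (Finset.even_sum _ fun z hz => Nat.not_odd_iff_even.1 (hno z hz))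
  exact ⟨z, by simpa [rooms] using hz, bijective_of_odd_card_isDoor hzodd⟩

/-- **Sperner's lemma** for the Kuhn triangulation of a simplex with side length `M`. The labels
may depend on the position `i` of a vertex in its simplex. -/
theorem exists_isKuhnCycle_bijective (hM : 0 < M)
    (l : Fin (N + 2) → (Fin (N + 2) → ℤ) → Fin (N + 2))
    (hl : ∀ i (y : Fin (N + 2) → ℤ), 0 ≤ y → ∑ k, y k = M → 0 < y (l i y)) :
    ∃ z, IsKuhnCycle z ∧ (∀ i, 0 ≤ z i) ∧ (∀ i, ∑ k, z i k = M) ∧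
      Function.Bijective fun i => l i (z i) := by
  have hlab := isSpernerLabelling_extendLabel (l := fun y => l (-weight y) y) hM
    fun y hy hsum => hl _ y hy hsum
  obtain ⟨z, hz, hbij⟩ := exists_isRoom_bijective hM hlab
  have hnonneg : ∀ i, 0 ≤ z i := fun i k => by
    obtain ⟨j, hj⟩ := hbij.2 k
    have hpos := hlab.pos (z j) (hz.sum_eq j)
    rw [show extendLabel _ (z j) = k from hj] at hpos
    have hnear := abs_le.1 (hz.isKuhnCycle.abs_coord_sub_le k j i)
    change 0 ≤ z i k
    omega
  refine ⟨z, hz.isKuhnCycle, hnonneg, hz.sum_eq, ?_⟩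
  convert hbij using 2 with i
  rw [Function.comp_apply, extendLabel, if_pos (hnonneg i), hz.weight_eq, neg_neg]

end Sperner

section Divisions

variable {n m : ℕ}

/-- The right end of the first `j` of consecutive intervals with the lengths `y`. -/
def cut (j : ℕ) : (Fin n → ℤ) →+ ℤ := ∑ k : Fin n with k.val < j, Pi.evalAddMonoidHom _ k

theorem cut_apply (j : ℕ) (y : Fin n → ℤ) : cut j y = ∑ k : Fin n with k.val < j, y k := by
  simp [cut]

theorem cut_zero (y : Fin n → ℤ) : cut 0 y = 0 := by
  simp [cut_apply]

theorem cut_of_le {j : ℕ} (hj : n ≤ j) (y : Fin n → ℤ) : cut j y = ∑ k, y k := by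
  rw [cut_apply, Finset.filter_true_of_mem fun k _ => k.2.trans_le hj]

theorem cut_succ (k : Fin n) (y : Fin n → ℤ) : cut (k.val + 1) y = cut k.val y + y k := by
  have hinsert : Finset.univ.filter (fun a : Fin n => a.val < k.val + 1) =
      insert k (Finset.univ.filter fun a : Fin n => a.val < k.val) := by
    ext a
    simp [le_iff_eq_or_lt, Fin.ext_iff]
  rw [cut_apply, cut_apply, hinsert, Finset.sum_insert (by simp), add_comm]

theorem cut_mono {y : Fin n → ℤ} (hy : 0 ≤ y) : Monotone fun j => cut j y := fun j j' h => by
  simp only [cut_apply]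
  exact Finset.sum_le_sum_of_subset_of_nonneg
    (Finset.monotone_filter_right _ fun k _ hk => hk.trans_le h) fun k _ _ => hy k

/-- The items between `a` and `b`, if item `e` extends from `2 * e` to `2 * e + 2`. -/
def itemsBetween (m : ℕ) (a b : ℤ) : Finset (Fin m) :=
  Finset.univ.filter fun e => a ≤ 2 * (e.val : ℤ) ∧ 2 * (e.val : ℤ) + 2 ≤ b

/-- The items that lie within interval number `k` if the intervals have the lengths `y`. -/
def piece (m : ℕ) (y : Fin n → ℤ) (k : Fin n) : Finset (Fin m) :=
  itemsBetween m (cut k y) (cut (k + 1) y)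

theorem mem_piece {y : Fin n → ℤ} {k : Fin n} {e : Fin m} :
    e ∈ piece m y k ↔ cut k y ≤ 2 * (e.val : ℤ) ∧ 2 * (e.val : ℤ) + 2 ≤ cut (k + 1) y :=
  Finset.mem_filter_univ e

theorem piece_eq_empty {y : Fin n → ℤ} {k : Fin n} (hk : y k ≤ 0) : piece m y k = ∅ := by
  refine Finset.eq_empty_of_forall_notMem fun e he => ?_
  rw [mem_piece, cut_succ] at he
  omega

theorem exists_pos_forall_le_piece {u : Valuation m} (hu : Monotone u) {y : Fin n → ℤ}
    (hy : 0 < ∑ k, y k) : ∃ k, 0 < y k ∧ ∀ k', u (piece m y k') ≤ u (piece m y k) := by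
  obtain ⟨k₀, -, hk₀⟩ :=
    Finset.exists_lt_of_sum_lt (s := Finset.univ) (f := 0) (g := y) (by simpa using hy)
  obtain ⟨k, hk, hmax⟩ := Finset.exists_max_image (Finset.univ.filter (0 < y ·))
    (fun k => u (piece m y k)) ⟨k₀, by simpa using hk₀⟩
  refine ⟨k, by simpa using hk, fun k' => ?_⟩
  by_cases hk' : 0 < y k'
  · exact hmax k' (by simpa using hk')
  · rw [piece_eq_empty (not_lt.1 hk')]
    exact hu (Finset.empty_subset _)

variable {ι : Type*}

/-- Each `z i` divides the interval of length `2 * m` into `n` consecutive intervals of the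
lengths `z i k`. From one division to another, neither an end of an interval nor a length changes
by more than `1`, that is, by half an item. -/
structure AdjacentDivisions (m : ℕ) (z : ι → Fin n → ℤ) : Prop where
  nonneg : ∀ i, 0 ≤ z i
  sum_eq : ∀ i, ∑ k, z i k = 2 * m
  abs_cut_sub_le : ∀ j i i', |cut j (z i') - cut j (z i)| ≤ 1
  abs_coord_sub_le : ∀ k i i', |z i' k - z i k| ≤ 1

theorem cut_transfer {N j : ℕ} (hj : 0 < j) (hjN : j < N + 2) (a : Fin (N + 2)) :
    cut j (transfer a) =
      (if a = ⟨j - 1, by omega⟩ then 1 else 0) - (if a = Fin.last _ then 1 else 0) := by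
  have hcut : cut j (transfer a) =
      (if a.val < j then 1 else 0) - (if (a + 1).val < j then 1 else 0) := by
    simp only [transfer, map_sub, cut_apply, Finset.sum_pi_single', Finset.mem_filter_univ]
  rw [hcut]
  rcases eq_or_ne a (Fin.last _) with rfl | ha
  · have hlast : ¬ N + 1 < j := by omega
    have hne : N + 1 ≠ j - 1 := by omega
    simp [Fin.ext_iff, hj, hlast, hne]
  · rw [if_neg ha, Fin.val_add_one_of_lt (Fin.lt_last_iff_ne_last.2 ha)]
    simp only [Fin.ext_iff]
    split_ifs <;> omega

theorem IsKuhnCycle.adjacentDivisions {N : ℕ} {z : Fin (N + 2) → Fin (N + 2) → ℤ}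
    (h : IsKuhnCycle z) (hz : ∀ i, 0 ≤ z i) (hsum : ∀ i, ∑ k, z i k = 2 * m) :
    AdjacentDivisions m z where
  nonneg := hz
  sum_eq := hsum
  abs_cut_sub_le j i i' := by
    rcases Nat.eq_zero_or_pos j with rfl | hj
    · simp [cut_zero]
    · rcases le_or_gt (N + 2) j with hjN | hjN
      · simp [cut_of_le hjN, hsum]
      · exact h.abs_sub_le (cut j) (cut_transfer hj hjN) i i'
  abs_coord_sub_le k i i' := h.abs_coord_sub_le k i i'

theorem exists_adjacentDivisions_bijective {N : ℕ} (hm : 0 < m)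
    (l : Fin (N + 2) → (Fin (N + 2) → ℤ) → Fin (N + 2))
    (hl : ∀ i (y : Fin (N + 2) → ℤ), ∑ k, y k = 2 * m → 0 < y (l i y)) :
    ∃ z, AdjacentDivisions m z ∧ Function.Bijective fun i => l i (z i) := by
  obtain ⟨z, h, hz, hsum, hbij⟩ :=
    exists_isKuhnCycle_bijective (M := 2 * m) (by omega) l fun i y _ => hl i y
  exact ⟨z, h.adjacentDivisions hz hsum, hbij⟩

end Divisions

section Mixed

variable {ι : Type*} {n m : ℕ} {z : ι → Fin n → ℤ}

/-- Bundles from the divisions `z` in which the division `z (o k)` determines bundle `k`. -/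
def mixedPiece (m : ℕ) (z : ι → Fin n → ℤ) (o : Fin n → ι) (k : Fin n) : Finset (Fin m) :=
  piece m (z (o k)) k

theorem AdjacentDivisions.pairwise_disjoint_mixedPiece (h : AdjacentDivisions m z)
    (o : Fin n → ι) : Pairwise (Function.onFun Disjoint (mixedPiece m z o)) := by
  refine (pairwise_disjoint_on _).2 fun k k' hlt => Finset.disjoint_left.2 fun e he he' => ?_
  rw [mixedPiece, mem_piece] at he he'
  have hnear := abs_le.1 (h.abs_cut_sub_le (k + 1) (o k) (o k'))
  have hmono : cut (k + 1) (z (o k')) ≤ cut k' (z (o k')) := cut_mono (h.nonneg _) hlt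
  omega

theorem AdjacentDivisions.card_mixedPiece_sdiff_le (h : AdjacentDivisions m z) (o : Fin n → ι)
    (k : Fin n) (i : ι) : (mixedPiece m z o k \ piece m (z i) k).card ≤ 1 := by
  rw [Finset.card_le_one]
  intro e he e' he'
  by_contra hne
  wlog hlt : e < e' generalizing e e'
  · exact this e' he' e he (Ne.symm hne) (lt_of_le_of_ne (not_lt.1 hlt) (Ne.symm hne))
  rw [Finset.mem_sdiff, mixedPiece, mem_piece, mem_piece, cut_succ, cut_succ] at he he'
  have hleft := abs_le.1 (h.abs_cut_sub_le k i (o k))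
  have hright := abs_le.1 (h.abs_cut_sub_le (k + 1) i (o k))
  have hlength := abs_le.1 (h.abs_coord_sub_le k i (o k))
  rw [cut_succ, cut_succ] at hright
  rw [Fin.lt_def] at hlt
  omega

open Classical in
/-- The items that are cut in the middle in one of the divisions. -/
noncomputable def halvedItems (m : ℕ) (z : ι → Fin n → ℤ) : Finset (Fin m) :=
  Finset.univ.filter fun e => ∃ j i, cut j (z i) = 2 * (e.val : ℤ) + 1

theorem mem_halvedItems {e : Fin m} :
    e ∈ halvedItems m z ↔ ∃ j i, cut j (z i) = 2 * (e.val : ℤ) + 1 := by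
  simp [halvedItems]

theorem AdjacentDivisions.card_halvedItems_le (h : AdjacentDivisions m z) :
    (halvedItems m z).card ≤ n := by
  refine (Finset.card_le_card_of_forall_subsingleton (t := Finset.range n)
    (fun e j => ∃ i, cut j (z i) = 2 * (e.val : ℤ) + 1) (fun e he => ?_) ?_).trans_eq
    (Finset.card_range n)
  · obtain ⟨j, i, hj⟩ := mem_halvedItems.1 he
    refine ⟨j, Finset.mem_range.2 (not_le.1 fun hnj => ?_), i, hj⟩
    rw [cut_of_le hnj, h.sum_eq] at hj
    omega
  · rintro j - e ⟨-, i, hi⟩ e' ⟨-, i', hi'⟩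
    have hnear := abs_le.1 (h.abs_cut_sub_le j i i')
    exact Fin.ext (by omega)

theorem AdjacentDivisions.mem_piece_of_notMem_halvedItems (h : AdjacentDivisions m z) {k : Fin n}
    {e : Fin m} (he : e ∉ halvedItems m z) {i : ι} (hi : e ∈ piece m (z i) k) (i' : ι) :
    e ∈ piece m (z i') k := by
  simp only [mem_halvedItems, not_exists] at he
  rw [mem_piece] at hi ⊢
  have hleft := abs_le.1 (h.abs_cut_sub_le k i i')
  have hright := abs_le.1 (h.abs_cut_sub_le (k + 1) i i')
  have := he k i'
  have := he (k + 1) i'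
  omega

theorem AdjacentDivisions.exists_mem_piece (h : AdjacentDivisions m z) {e : Fin m}
    (he : e ∉ halvedItems m z) (i : ι) : ∃ k, e ∈ piece m (z i) k := by
  simp only [mem_halvedItems, not_exists] at he
  have htop : ¬ cut n (z i) ≤ 2 * (e.val : ℤ) := by
    rw [cut_of_le le_rfl, h.sum_eq]
    omega
  obtain ⟨j, hjn, hj, hj'⟩ : ∃ j < n, cut j (z i) ≤ 2 * (e.val : ℤ) ∧
      ¬ cut (j + 1) (z i) ≤ 2 * (e.val : ℤ) := by
    by_contra! hstep
    exact htop (Nat.le_induction (P := fun j _ => j ≤ n → cut j (z i) ≤ 2 * (e.val : ℤ))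
      (fun _ => by rw [cut_zero]; positivity)
      (fun j _ ih hj => hstep j hj (ih (Nat.le_of_succ_le hj))) n n.zero_le le_rfl)
  refine ⟨⟨j, hjn⟩, mem_piece.2 ⟨hj, ?_⟩⟩
  have := he (j + 1) i
  dsimp only
  omega

/-- The items outside the bundles `C`. -/
def leftover (C : Fin n → Finset (Fin m)) : Finset (Fin m) :=
  Finset.univ.filter fun e => ∀ k, e ∉ C k

theorem mem_leftover {C : Fin n → Finset (Fin m)} {e : Fin m} :
    e ∈ leftover C ↔ ∀ k, e ∉ C k :=
  Finset.mem_filter_univ e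

open Classical in
/-- The numbers of the mixed bundles that lie within the respective bundles of all the divisions.
Such a bundle tolerates an additional item. -/
noncomputable def intactPieces (m : ℕ) (z : ι → Fin n → ℤ) (o : Fin n → ι) : Finset (Fin n) :=
  Finset.univ.filter fun k => ∀ i, mixedPiece m z o k ⊆ piece m (z i) k

theorem mem_intactPieces {o : Fin n → ι} {k : Fin n} :
    k ∈ intactPieces m z o ↔ ∀ i, mixedPiece m z o k ⊆ piece m (z i) k := by
  simp [intactPieces]

theorem AdjacentDivisions.leftover_subset_halvedItems (h : AdjacentDivisions m z) [Nonempty ι]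
    (o : Fin n → ι) : leftover (mixedPiece m z o) ⊆ halvedItems m z := by
  intro e he
  by_contra hhalved
  obtain ⟨k, hk⟩ := h.exists_mem_piece hhalved (Classical.arbitrary ι)
  exact mem_leftover.1 he k (h.mem_piece_of_notMem_halvedItems hhalved hk (o k))

theorem AdjacentDivisions.exists_mem_halvedItems (h : AdjacentDivisions m z) {o : Fin n → ι}
    {k : Fin n} (hk : k ∉ intactPieces m z o) : ∃ e ∈ mixedPiece m z o k, e ∈ halvedItems m z := by
  simp only [mem_intactPieces, not_forall, Finset.not_subset] at hk
  obtain ⟨i, e, he, he'⟩ := hk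
  exact ⟨e, he, by_contra fun hhalved =>
    he' (h.mem_piece_of_notMem_halvedItems hhalved he i)⟩

/-- At most `n` items are halved. Each leftover item is one of them, and each bundle that is not
intact contains another one. -/
theorem AdjacentDivisions.card_leftover_le (h : AdjacentDivisions m z) [Nonempty ι]
    (o : Fin n → ι) : (leftover (mixedPiece m z o)).card ≤ (intactPieces m z o).card := by
  have hdamaged : (intactPieces m z o)ᶜ.card ≤
      (halvedItems m z \ leftover (mixedPiece m z o)).card := by
    refine Finset.card_le_card_of_forall_subsingleton (fun k e => e ∈ mixedPiece m z o k)
      (fun k hk => ?_) fun e _ k hk k' hk' => ?_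
    · obtain ⟨e, hek, he⟩ := h.exists_mem_halvedItems (Finset.mem_compl.1 hk)
      exact ⟨e, Finset.mem_sdiff.2 ⟨he, fun hleft => mem_leftover.1 hleft k hek⟩, hek⟩
    · by_contra hne
      exact Finset.disjoint_left.1 (h.pairwise_disjoint_mixedPiece o hne) hk.2 hk'.2
  have hsplit := Finset.card_sdiff_add_card_eq_card (h.leftover_subset_halvedItems o)
  have hcompl := (intactPieces m z o).card_compl_add_card
  rw [Fintype.card_fin] at hcompl
  have := h.card_halvedItems_le
  omega

end Mixed

section Completion

variable {n m : ℕ} {C : Fin n → Finset (Fin m)} {Q : Finset (Fin n)} {A : Allocation n m}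

/-- The allocation `A` gives bundle `C k` to agent `k` and distributes the remaining items among
the agents in `Q`, at most one item to each. -/
structure IsCompletion (C : Fin n → Finset (Fin m)) (Q : Finset (Fin n)) (A : Allocation n m) :
    Prop where
  eq_of_mem : ∀ k, ∀ e ∈ C k, A e = k
  mem_of_mem_leftover : ∀ e ∈ leftover C, A e ∈ Q
  injOn_leftover : Set.InjOn A (leftover C)

theorem exists_isCompletion (hC : Pairwise (Function.onFun Disjoint C))
    (hQ : (leftover C).card ≤ Q.card) : ∃ A, IsCompletion C Q A := by
  classical
  obtain ⟨g⟩ : Nonempty (leftover C ↪ Q) :=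
    Function.Embedding.nonempty_of_card_le (by simpa using hQ)
  let A : Allocation n m := fun e =>
    if h : ∃ k, e ∈ C k then h.choose else g ⟨e, mem_leftover.2 (not_exists.1 h)⟩
  have hA : ∀ e (he : e ∈ leftover C), A e = g ⟨e, he⟩ := fun e he =>
    dif_neg (not_exists.2 (mem_leftover.1 he))
  refine ⟨A, fun k e he => ?_, fun e he => hA e he ▸ (g ⟨e, he⟩).2, fun e he e' he' heq => ?_⟩
  · have h : ∃ k, e ∈ C k := ⟨k, he⟩
    rw [show A e = h.choose from dif_pos h]
    by_contra hne
    exact Finset.disjoint_left.1 (hC hne) h.choose_spec he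
  · rw [hA e he, hA e' he'] at heq
    exact congrArg Subtype.val (g.injective (Subtype.ext heq))

theorem Allocation.mem_bundle {k : Fin n} {e : Fin m} : e ∈ A.bundle k ↔ A e = k :=
  Finset.mem_filter_univ e

namespace IsCompletion

theorem subset_bundle (h : IsCompletion C Q A) (k : Fin n) : C k ⊆ A.bundle k :=
  fun e he => Allocation.mem_bundle.2 (h.eq_of_mem k e he)

theorem mem_leftover_of_mem_sdiff (h : IsCompletion C Q A) {k : Fin n} {e : Fin m}
    (he : e ∈ A.bundle k \ C k) : e ∈ leftover C := by
  obtain ⟨hek, hnot⟩ := Finset.mem_sdiff.1 he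
  refine mem_leftover.2 fun k' hk' => hnot ?_
  rwa [← Allocation.mem_bundle.1 hek, h.eq_of_mem k' e hk']

theorem card_bundle_sdiff_le (h : IsCompletion C Q A) (k : Fin n) :
    (A.bundle k \ C k).card ≤ 1 :=
  Finset.card_le_one.2 fun _ he _ he' =>
    h.injOn_leftover (h.mem_leftover_of_mem_sdiff he) (h.mem_leftover_of_mem_sdiff he')
      ((Allocation.mem_bundle.1 (Finset.mem_sdiff.1 he).1).trans
        (Allocation.mem_bundle.1 (Finset.mem_sdiff.1 he').1).symm)

theorem bundle_eq (h : IsCompletion C Q A) {k : Fin n} (hk : k ∉ Q) : A.bundle k = C k := by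
  refine (h.subset_bundle k).antisymm' fun e he => ?_
  by_contra hnot
  have hQ := h.mem_of_mem_leftover e (h.mem_leftover_of_mem_sdiff (Finset.mem_sdiff.2 ⟨he, hnot⟩))
  exact hk (Allocation.mem_bundle.1 he ▸ hQ)

end IsCompletion

theorem isEF1_of_card_sdiff_le {v : Fin n → Valuation m} (hv : ∀ i, Monotone (v i))
    (B : Fin n → Fin n → Finset (Fin m)) (hown : ∀ i, B i i ⊆ A.bundle i)
    (hbest : ∀ i j, v i (B i j) ≤ v i (B i i)) (hother : ∀ i j, (A.bundle j \ B i j).card ≤ 1) :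
    IsEF1 v A := by
  intro i j _
  have hle := (hbest i j).trans (hv i (hown i))
  rcases (A.bundle j \ B i j).eq_empty_or_nonempty with h | ⟨e, he⟩
  · exact .inl ((hv i (Finset.sdiff_eq_empty_iff_subset.1 h)).trans hle)
  · refine .inr ⟨e, (Finset.mem_sdiff.1 he).1, (hv i fun e' he' => ?_).trans hle⟩
    rw [Finset.mem_sdiff, Finset.mem_singleton] at he'
    by_contra hnot
    exact he'.2 (Finset.card_le_one.1 (hother i j) e' (Finset.mem_sdiff.2 ⟨he'.1, hnot⟩) e he)

theorem bundle_comp_perm (π : Equiv.Perm (Fin n)) (i : Fin n) :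
    Allocation.bundle (π ∘ A) (π i) = A.bundle i := by
  ext e
  simp [Allocation.mem_bundle]

theorem IsCompletion.isEF1 {z : Fin n → Fin n → ℤ} (hz : AdjacentDivisions m z)
    {v : Fin n → Valuation m} (hv : ∀ i, Monotone (v i)) {ρ : Equiv.Perm (Fin n)}
    (hbest : ∀ i k, v i (piece m (z i) k) ≤ v i (piece m (z i) (ρ i)))
    (hA : IsCompletion (mixedPiece m z ρ.symm) (intactPieces m z ρ.symm) A) :
    IsEF1 v (ρ.symm ∘ A) := by
  have hbundle : ∀ i, Allocation.bundle (ρ.symm ∘ A) i = A.bundle (ρ i) := fun i => by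
    rw [← bundle_comp_perm ρ.symm (ρ i), ρ.symm_apply_apply]
  refine isEF1_of_card_sdiff_le hv (fun i j => piece m (z i) (ρ j)) (fun i => ?_)
    (fun i j => hbest i (ρ j)) fun i j => ?_
  · rw [hbundle]
    simpa only [mixedPiece, ρ.symm_apply_apply] using hA.subset_bundle (ρ i)
  · rw [hbundle]
    by_cases hj : ρ j ∈ intactPieces m z ρ.symm
    · exact (Finset.card_le_card (Finset.sdiff_subset_sdiff subset_rfl
        (mem_intactPieces.1 hj i))).trans (hA.card_bundle_sdiff_le (ρ j))
    · rw [hA.bundle_eq hj]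
      exact hz.card_mixedPiece_sdiff_le ρ.symm (ρ j) i

end Completion

section Codes

variable {n m : ℕ}

/-- A description of `n` bundles of `m` items: the interval lengths of one division, and for each
interval how far its left and its right end are shifted, the shift being the number minus `1`. -/
abbrev IntervalCode (n m : ℕ) : Type :=
  Finset.finsuppAntidiag (Finset.univ : Finset (Fin n)) (2 * m) × (Fin n → Fin 3) × (Fin n → Fin 3)

/-- The bundles described by an interval code. -/
def IntervalCode.bundles (K : IntervalCode n m) (k : Fin n) : Finset (Fin m) :=
  itemsBetween m (cut k (fun k => (K.1.val k : ℤ)) + K.2.1 k - 1)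
    (cut (k + 1) (fun k => (K.1.val k : ℤ)) + K.2.2 k - 1)

theorem AdjacentDivisions.exists_intervalCode {ι : Type*} {z : ι → Fin n → ℤ}
    (h : AdjacentDivisions m z) [Nonempty ι] (o : Fin n → ι) :
    ∃ K : IntervalCode n m, K.bundles = mixedPiece m z o := by
  obtain ⟨i₀⟩ := ‹Nonempty ι›
  have hshift : ∀ j i, ∃ d : Fin 3, cut j (z i₀) + d - 1 = cut j (z i) := fun j i => by
    have hnear := abs_le.1 (h.abs_cut_sub_le j i₀ i)
    exact ⟨⟨(cut j (z i) - cut j (z i₀) + 1).toNat, by omega⟩, by dsimp only; omega⟩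
  choose d hd using hshift
  have hlengths : (fun k => ((z i₀ k).toNat : ℤ)) = z i₀ :=
    funext fun k => Int.toNat_of_nonneg (h.nonneg i₀ k)
  have hsum : ∑ k, (z i₀ k).toNat = 2 * m := by
    zify
    rw [← h.sum_eq i₀]
    exact Finset.sum_congr rfl fun k _ => congrFun hlengths k
  refine ⟨⟨⟨Finsupp.equivFunOnFinite.symm fun k => (z i₀ k).toNat, ?_⟩,
    fun k => d k (o k), fun k => d (k + 1) (o k)⟩, funext fun k => ?_⟩
  · exact Finset.mem_finsuppAntidiag.2 ⟨hsum, Finset.subset_univ _⟩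
  · simp only [IntervalCode.bundles, Finsupp.equivFunOnFinite_symm_apply_apply, hlengths, hd]
    rfl

/-- A description of an allocation: the bundles before the leftover items are distributed, and the
agents who may receive one of these. -/
abbrev AllocationCode (n m : ℕ) : Type := IntervalCode n m × Finset (Fin n)

instance [NeZero n] : Nonempty (AllocationCode n m) :=
  ⟨⟨⟨Finsupp.single 0 (2 * m), Finset.mem_finsuppAntidiag.2
    ⟨by simp [Finsupp.single_apply], Finset.subset_univ _⟩⟩,
    0, 0⟩, ∅⟩

open Classical in
/-- An allocation described by a code. It is arbitrary if the code does not describe any. -/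
noncomputable def AllocationCode.decode [NeZero n] (K : AllocationCode n m) : Allocation n m :=
  Classical.epsilon (IsCompletion K.1.bundles K.2)

theorem exists_code_isEF1 [NeZero n] (hm : 0 < m) {v : Fin n → Valuation m}
    (hv : ∀ i, Monotone (v i)) :
    ∃ (K : AllocationCode n m) (π : Equiv.Perm (Fin n)), IsEF1 v (π ∘ K.decode) := by
  obtain _ | _ | N := n
  · exact absurd rfl (NeZero.ne 0)
  · exact ⟨Classical.arbitrary _, 1, fun i j hij => absurd (Fin.ext (by omega)) hij⟩
  have hbest : ∀ i (y : Fin (N + 2) → ℤ), ∑ k, y k = 2 * m →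
      ∃ k, 0 < y k ∧ ∀ k', v i (piece m y k') ≤ v i (piece m y k) :=
    fun i y hy => exists_pos_forall_le_piece (hv i) (by omega)
  choose! l hpos hmax using hbest
  obtain ⟨z, hz, hbij⟩ := exists_adjacentDivisions_bijective hm l hpos
  let ρ := Equiv.ofBijective _ hbij
  obtain ⟨K, hK⟩ := hz.exists_intervalCode ρ.symm
  have hcompletion := exists_isCompletion (hz.pairwise_disjoint_mixedPiece ρ.symm)
    (hz.card_leftover_le ρ.symm)
  rw [← hK] at hcompletion
  refine ⟨(K, intactPieces m z ρ.symm), ρ.symm,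
    IsCompletion.isEF1 hz hv (fun i => hmax i (z i) (hz.sum_eq i)) ?_⟩
  exact hK ▸ Classical.epsilon_spec hcompletion

end Codes

section Counting

theorem choose_le_three_mul_div_pow (N k : ℕ) : (N.choose k : ℝ) ≤ (3 * N / k) ^ k := by
  rcases Nat.eq_zero_or_pos k with rfl | hk
  · simp
  have hfactorial : (k : ℝ) ^ k / k.factorial ≤ 3 ^ k := by
    calc (k : ℝ) ^ k / k.factorial ≤ Real.exp k := Real.pow_div_factorial_le_exp _ k.cast_nonneg k
      _ = Real.exp 1 ^ k := by rw [← Real.exp_nat_mul, mul_one]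
      _ ≤ 3 ^ k := by gcongr; exact Real.exp_one_lt_three.le
  calc (N.choose k : ℝ) ≤ (N : ℝ) ^ k / k.factorial := Nat.choose_le_pow_div k N
    _ = (N / k : ℝ) ^ k * (k ^ k / k.factorial) := by
      rw [← mul_div_assoc, ← mul_pow, div_mul_cancel₀ _ (by positivity)]
    _ ≤ (N / k : ℝ) ^ k * 3 ^ k := by gcongr
    _ = (3 * N / k) ^ k := by rw [← mul_pow, mul_comm, mul_div_assoc]

theorem card_allocationCode_le {n m : ℕ} (hnm : n ≤ m) :
    (Fintype.card (AllocationCode n m) : ℝ) ≤ (162 * (m / n)) ^ n := by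
  have hcard : Fintype.card (AllocationCode n m) =
      (n + 2 * m - 1).choose (2 * m) * (3 ^ n * 3 ^ n) * 2 ^ n := by
    simp [AllocationCode, IntervalCode, Finset.card_finsuppAntidiag_nat_eq_choose]
  have hchoose : (n + 2 * m - 1).choose (2 * m) ≤ (3 * m).choose n := by
    calc (n + 2 * m - 1).choose (2 * m) ≤ (n + 2 * m).choose (2 * m) :=
          Nat.choose_le_choose _ (Nat.sub_le _ _)
      _ = (n + 2 * m).choose n := (Nat.choose_symm_of_eq_add rfl).symm
      _ ≤ (3 * m).choose n := Nat.choose_le_choose _ (by omega)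
  calc (Fintype.card (AllocationCode n m) : ℝ)
      = (n + 2 * m - 1).choose (2 * m) * (3 ^ n * 3 ^ n) * 2 ^ n := by exact_mod_cast hcard
    _ ≤ (3 * m).choose n * (3 ^ n * 3 ^ n) * 2 ^ n := by gcongr
    _ ≤ (3 * (3 * m : ℕ) / n) ^ n * (3 ^ n * 3 ^ n) * 2 ^ n := by
      gcongr
      exact choose_le_three_mul_div_pow _ _
    _ = (162 * (m / n)) ^ n := by
      rw [← mul_pow, ← mul_pow, ← mul_pow]
      push_cast
      ring

theorem natClog_two_le_of_le_pow {c n : ℕ} (hc : 0 < c) {r : ℝ} (hr : 2 ≤ r)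
    (h : (c : ℝ) ≤ (162 * r) ^ n) : (Nat.clog 2 c : ℝ) ≤ 18 * (n * Real.logb 2 r) := by
  have hr9 : 162 * r ≤ r ^ 9 := by
    have hpow : (2 : ℝ) ^ 8 ≤ r ^ 8 := by gcongr
    nlinarith
  calc (Nat.clog 2 c : ℝ) ≤ 2 * Real.logb 2 c := natClog_two_le c
    _ ≤ 2 * Real.logb 2 ((r ^ 9) ^ n) := by
      gcongr
      · exact one_lt_two
      · exact h.trans (by gcongr)
    _ = 18 * (n * Real.logb 2 r) := by
      rw [Real.logb_pow, Real.logb_pow]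
      push_cast
      ring

end Counting

section Bounds

variable {n m : ℕ} {C : Set (Valuation m)}

theorem communicationComplexity_additive_le_logb (hn : 1 ≤ n) :
    (communicationComplexity (instances n (additiveValuations m)) IsEF1 : ENNReal) ≤
      ENNReal.ofReal (2 * (m * Real.logb 2 m)) := by
  have : NeZero n := ⟨by omega⟩
  refine toENNReal_le_ofReal (communicationComplexity_additive_le n m) ?_
  calc ((m * Nat.clog 2 m : ℕ) : ℝ) = m * Nat.clog 2 m := Nat.cast_mul _ _
    _ ≤ m * (2 * Real.logb 2 m) := by gcongr; exact natClog_two_le m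
    _ = 2 * (m * Real.logb 2 m) := by ring

theorem isEF1_castLE (hmn : m ≤ n) {v : Fin n → Valuation m} (hv : ∀ i, Monotone (v i)) :
    IsEF1 v (Fin.castLE hmn) := by
  refine isEF1_of_card_sdiff_le hv (fun _ _ => ∅) (fun _ => Finset.empty_subset _)
    (fun _ _ => le_rfl) fun _ j => ?_
  rw [Finset.sdiff_empty, Finset.card_le_one]
  intro e he e' he'
  exact Fin.castLE_injective hmn
    ((Allocation.mem_bundle.1 he).trans (Allocation.mem_bundle.1 he').symm)

theorem card_allocationCode_prod_perm_le (hn : 1 ≤ n) (hnm : n ≤ m) :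
    (Fintype.card (AllocationCode n m × Equiv.Perm (Fin n)) : ℝ) ≤ (162 * m) ^ n := by
  have hn' : (n : ℝ) ≠ 0 := by positivity
  rw [Fintype.card_prod, Fintype.card_perm, Fintype.card_fin, Nat.cast_mul]
  calc (Fintype.card (AllocationCode n m) : ℝ) * n.factorial
      ≤ (162 * (m / n)) ^ n * n ^ n := by
        gcongr
        · exact card_allocationCode_le hnm
        · exact_mod_cast n.factorial_le_pow
    _ = (162 * m) ^ n := by rw [← mul_pow, mul_assoc, div_mul_cancel₀ _ hn']

theorem descriptionComplexity_le_logb (hn : 1 ≤ n) (hm : 1 ≤ m) (hC : ∀ u ∈ C, Monotone u) :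
    (descriptionComplexity (instances n C) IsEF1 : ENNReal) ≤
      ENNReal.ofReal (18 * (n * Real.logb 2 m)) := by
  rcases le_or_gt m n with hmn | hnm
  · have hlog : 0 ≤ Real.logb 2 (m : ℝ) := Real.logb_nonneg one_lt_two (by exact_mod_cast hm)
    exact toENNReal_le_ofReal (communicationComplexity_le (.output (Fin.castLE hmn)) fun y hy =>
      ⟨isEF1_castLE hmn fun i => hC _ (hy i), le_rfl⟩) (by rw [Nat.cast_zero]; positivity)
  · have : NeZero n := ⟨by omega⟩
    refine toENNReal_le_ofReal (communicationComplexity_le_clog_card ()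
      (fun κ : AllocationCode n m × Equiv.Perm (Fin n) => κ.2 ∘ κ.1.decode) fun y hy => ?_)
      (natClog_two_le_of_le_pow Fintype.card_pos (by exact_mod_cast (by omega : 2 ≤ m))
        (card_allocationCode_prod_perm_le hn hnm.le))
    obtain ⟨K, π, h⟩ := exists_code_isEF1 hm fun i => hC _ (hy i)
    exact ⟨(K, π), fun y' _ hy' => hy' ▸ h⟩

theorem IsEF1.of_comp_perm {u : Valuation m} {A : Allocation n m} {π : Equiv.Perm (Fin n)}
    (h : IsEF1 (fun _ => u) (π ∘ A)) : IsEF1 (fun _ => u) A := by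
  intro i j hij
  simpa only [bundle_comp_perm] using h (π i) (π j) (π.injective.ne hij)

theorem communicationComplexity_identical_le_logb (hn : 1 ≤ n) (hm : 2 * n ≤ m)
    (hC : ∀ u ∈ C, Monotone u) :
    (communicationComplexity (identicalInstances n C) IsEF1 : ENNReal) ≤
      ENNReal.ofReal (18 * (n * Real.logb 2 ((m : ℝ) / n))) := by
  have : NeZero n := ⟨by omega⟩
  have hr : (2 : ℝ) ≤ m / n := by
    rw [le_div_iff₀ (by positivity)]
    exact_mod_cast hm
  refine toENNReal_le_ofReal (communicationComplexity_le_clog_card 0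
    (AllocationCode.decode (n := n) (m := m)) fun x hx => ?_)
    (natClog_two_le_of_le_pow Fintype.card_pos hr (card_allocationCode_le (by omega)))
  obtain ⟨u, hu, hx⟩ := hx
  obtain ⟨K, π, h⟩ := exists_code_isEF1 (n := n) (by omega) fun _ => hC u hu
  refine ⟨K, ?_⟩
  rintro x' ⟨u', -, hx'⟩ heq
  obtain rfl : u' = u := by rw [← hx' 0, heq, hx]
  obtain rfl : x' = fun _ => u' := funext hx'
  exact h.of_comp_perm

theorem monotone_of_mem_additiveValuations {u : Valuation m} (hu : u ∈ additiveValuations m) :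
    Monotone u := by
  obtain ⟨w, hw, hadd⟩ := hu
  intro S T hST
  rw [hadd, hadd]
  exact Finset.sum_le_sum_of_subset_of_nonneg hST fun e _ _ => hw e

end Bounds

end FairAllocation

theorem proposition6_general :
    (∃ c : ℝ, 0 < c ∧ ∀ n m : ℕ, 1 ≤ n →
      (communicationComplexity (instances n (additiveValuations m)) IsEF1 : ENNReal) ≤
        ENNReal.ofReal (c * (m * Real.logb 2 m))) ∧
    (∃ c : ℝ, 0 < c ∧ ∀ n m : ℕ, 1 ≤ n → 1 ≤ m →
      ∀ C : Set (Valuation m), (∀ u ∈ C, Monotone u) →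
        (descriptionComplexity (instances n C) IsEF1 : ENNReal) ≤
          ENNReal.ofReal (c * (n * Real.logb 2 m))) ∧
    (∃ c : ℝ, 0 < c ∧ ∀ n m : ℕ, 1 ≤ n → 2 * n ≤ m →
      ∀ C : Set (Valuation m), (∀ u ∈ C, Monotone u) →
        (communicationComplexity (identicalInstances n C) IsEF1 : ENNReal) ≤
          ENNReal.ofReal (c * (n * Real.logb 2 ((m : ℝ) / n)))) :=
  ⟨⟨2, by norm_num, fun _ _ hn => communicationComplexity_additive_le_logb hn⟩,
    ⟨18, by norm_num, fun _ _ hn hm _ hC => descriptionComplexity_le_logb hn hm hC⟩,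
    ⟨18, by norm_num, fun _ _ hn hm _ hC => communicationComplexity_identical_le_logb hn hm hC⟩⟩

theorem proposition6 :
    -- additive valuations: communication complexity `O(m log m)`
    (∃ c : ℝ, 0 < c ∧ ∀ n m : ℕ, 1 ≤ n → 2 * n ≤ m →
      (communicationComplexity (instances n (additiveValuations m)) IsEF1 : ENNReal) ≤
        ENNReal.ofReal (c * (m * Real.logb 2 m))) ∧
    -- additive valuations: description complexity `O(n log m)`
    (∃ c : ℝ, 0 < c ∧ ∀ n m : ℕ, 1 ≤ n → 2 * n ≤ m →
      (descriptionComplexity (instances n (additiveValuations m)) IsEF1 : ENNReal) ≤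
        ENNReal.ofReal (c * (n * Real.logb 2 m))) ∧
    -- identical valuations: communication complexity `O(n log (m / n))`
    (∃ c : ℝ, 0 < c ∧ ∀ n m : ℕ, 1 ≤ n → 2 * n ≤ m →
      ∀ C : Set (Valuation m), C ⊆ monotoneValuations m →
        (communicationComplexity (identicalInstances n C) IsEF1 : ENNReal) ≤
          ENNReal.ofReal (c * (n * Real.logb 2 ((m : ℝ) / n)))) := by
  obtain ⟨⟨c₁, h₁, hadd⟩, ⟨c₂, h₂, hdesc⟩, c₃, h₃, hid⟩ := proposition6_general
  exact ⟨⟨c₁, h₁, fun n m hn _ => hadd n m hn⟩,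
    ⟨c₂, h₂, fun n m hn hm =>
      hdesc n m hn (by omega) _ fun _ => monotone_of_mem_additiveValuations⟩,
    ⟨c₃, h₃, fun n m hn hm C hC => hid n m hn hm C fun _ hu => (hC hu).2⟩⟩
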